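/- For integers $0\le d\le n$ let $\mathrm{Sym}_{d,n}=\sum_{S\subseteq\{1,\dots,n\},\,|S|=d}\ \prod_{i\in S}x_i\in\mathbb{R}[x_1,\dots,x_n]$ be the elementary symmetric polynomial of degree $d$ in $n$ variables. For $f\in\mathbb{R}[x_1,\dots,x_n]$ and $k\ge 0$, let $\partial^{=k}f$ be the real vector space spanned by all partial derivatives of $f$ of order $k$ (repeated differentiation with respect to the same variable is allowed). Let $M$ be the matrix whose rows are indexed by the $k$-element subsets $I\subseteq\{1,\dots,n\}$, row $I$ consisting of the coordinates of $\partial_I f=\bigl(\prod_{i\in I}\partial/\partial x_i\bigr)f$ in the scaled monomial basis $x_1^{\alpha_1}\cdots x_n^{\alpha_n}/(\alpha_1!\cdots\alpha_n!)$; the columns are indexed by the finitely many monomials occurring in at least one of these derivatives. Put $B=M^{T}M$. Proposition. Let $k',d',n'$ be positive integers with $k'<d'<n'/2$. For every integer $m\ge 1$ let $f_m=\mathrm{Sym}_{d'm,\,n'm}$, let $u_m=\dim\partial^{=k'm}f_m$, let $B_m$ be the matrix $B$ constructed above from $f=f_m$ and $k=k'm$, and let $v_m=\dfrac{(\mathrm{Tr}\,B_m)^2}{\mathrm{Tr}(B_m^2)}$.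 Then $\dfrac{v_m}{u_m}\to 0$ as $m\to\infty$. -/

import Mathlib

open Filter Topology

noncomputable section

namespace PartialDerivatives

open MvPolynomial

/-- The partial derivative `∂_β f`, where `f` is differentiated `β i` times with respect to the
variable `x_i`, i.e. `∂_0^{β 0} (∂_1^{β 1} (⋯ (∂_{n-1}^{β (n-1)} f)))`. -/
def partialDeriv {n : ℕ} (β : Fin n → ℕ) (f : MvPolynomial (Fin n) ℝ) :
    MvPolynomial (Fin n) ℝ :=
  (List.finRange n).foldr (fun i g => (⇑(pderiv i))^[β i] g) f

/-- The linear space `∂^{=k} f` spanned by all partial derivatives of `f` of order `k`. -/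
def derivSpace {n : ℕ} (k : ℕ) (f : MvPolynomial (Fin n) ℝ) :
    Submodule ℝ (MvPolynomial (Fin n) ℝ) :=
  Submodule.span ℝ {g | ∃ β : Fin n → ℕ, ∑ i, β i = k ∧ g = partialDeriv β f}

/-- The dimension of `∂^{=k} f`. The space is spanned by finitely many polynomials, so `finrank`
is its true dimension. -/
def derivDim {n : ℕ} (k : ℕ) (f : MvPolynomial (Fin n) ℝ) : ℕ :=
  Module.finrank ℝ (derivSpace k f)

/-- The derivative `∂_I f` for a set `I` of variables: differentiate exactly once with respect to
each variable in `I`. -/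
def setDeriv {n : ℕ} (I : Finset (Fin n)) (f : MvPolynomial (Fin n) ℝ) :
    MvPolynomial (Fin n) ℝ :=
  partialDeriv (fun i => if i ∈ I then 1 else 0) f

/-- The coordinate of `f` on the element `x^J / J!` of the scaled monomial basis, where
`J! = ∏ i, (J i)!`. -/
def scaledCoeff {n : ℕ} (J : Fin n →₀ ℕ) (f : MvPolynomial (Fin n) ℝ) : ℝ :=
  (∏ i, ((J i).factorial : ℝ)) * coeff J f

/-- The rows of the matrix of partial derivatives: the `k`-element sets of variables. -/
def rowIndex (n k : ℕ) : Finset (Finset (Fin n)) :=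
  Finset.powersetCard k Finset.univ

/-- The columns of the matrix of partial derivatives: the exponent vectors of all the monomials
that occur in some `∂_I f` with `|I| = k`. (Any other column would be identically zero.) -/
def colIndex {n : ℕ} (k : ℕ) (f : MvPolynomial (Fin n) ℝ) : Finset (Fin n →₀ ℕ) :=
  (rowIndex n k).biUnion fun I => (setDeriv I f).support

/-- The matrix `M` of partial derivatives of order `k` of `f`: row `I` is the expansion of `∂_I f`
in the scaled monomial basis. -/
def derivMatrix {n : ℕ} (k : ℕ) (f : MvPolynomial (Fin n) ℝ) :
    Matrix (rowIndex n k) (colIndex k f) ℝ :=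
  Matrix.of fun I J => scaledCoeff J.1 (setDeriv I.1 f)

/-- The symmetric matrix `B = Mᵀ M`. -/
def gramMatrix {n : ℕ} (k : ℕ) (f : MvPolynomial (Fin n) ℝ) :
    Matrix (colIndex k f) (colIndex k f) ℝ :=
  (derivMatrix k f).transpose * derivMatrix k f

/-- The lower bound `(Tr B)² / Tr (B²)` given by the trace method. -/
def traceBound {n : ℕ} (k : ℕ) (f : MvPolynomial (Fin n) ℝ) : ℝ :=
  (gramMatrix k f).trace ^ 2 / (gramMatrix k f * gramMatrix k f).trace

end PartialDerivatives

end

/-! For `f = esymm` of degree `k + l` in `n` variables, the derivative matrix is, up to zero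
columns, the 0/1 disjointness matrix `D` of `k`-sets against `l`-sets. When `k + l ≤ n`, `D` has
full rank, so `u ≥ C(n, min k l)`. The trace method loses a factor of order `n`: `Tr (D Dᵀ) = C(n,k)
C(n-k,l)`, while `Tr ((D Dᵀ)²)` already receives `C(n-k-1,l)²` from each pair `I, I'` differing by
one exchange, and every `I` has `k (n-k)` such neighbours. For `2(k+l) ≤ n` the two binomials are
within a factor 2, whence `v ≤ C(n,k) · 4/n`. Exchanging `k` and `l` replaces `C(n,k)` by `C(n, min
k l)`, so `v/u ≤ 4/n` (`traceBound_div_derivDim_esymm_le`). -/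

namespace PartialDerivatives

open MvPolynomial Finset

/-! ### Full rank of set disjointness -/

/-- The number of `l`-sets disjoint from `I` that meet `I₀` in exactly `j` elements. -/
theorem card_disjoint_inter_eq {α : Type*} [Fintype α] [DecidableEq α] (I I₀ : Finset α)
    {j l : ℕ} (hjl : j ≤ l) :
    #{J ∈ powersetCard l (univ : Finset α) | #(J ∩ I₀) = j ∧ Disjoint I J} =
      (#(I₀ \ I)).choose j * (#(I₀ ∪ I)ᶜ).choose (l - j) := by
  rw [← card_powersetCard, ← card_powersetCard, ← card_product]
  refine card_nbij' (fun J => (J ∩ I₀, J \ I₀)) (fun p => p.1 ∪ p.2) ?_ ?_ ?_ ?_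
  · intro J hJ
    simp only [coe_filter, mem_powersetCard, subset_univ, true_and, Set.mem_ofPred_eq] at hJ
    obtain ⟨h1, h2, h3⟩ := hJ
    rw [disjoint_left] at h3
    have := card_sdiff_add_card_inter J I₀
    simp only [coe_product, Set.mem_prod, mem_coe, mem_powersetCard]
    refine ⟨⟨?_, h2⟩, ?_, by omega⟩
    · intro x hx; simp at hx ⊢; exact ⟨hx.2, fun h => h3 h hx.1⟩
    · intro x hx; simp at hx ⊢; exact ⟨hx.2, fun h => h3 h hx.1⟩
  · rintro ⟨A, C⟩ h
    simp only [coe_product, Set.mem_prod, mem_coe, mem_powersetCard] at h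
    obtain ⟨⟨hA, hAc⟩, hC, hCc⟩ := h
    have hA' : ∀ x ∈ A, x ∈ I₀ ∧ x ∉ I := fun x hx => by simpa using hA hx
    have hC' : ∀ x ∈ C, x ∉ I₀ ∧ x ∉ I := fun x hx => by simpa using hC hx
    have hd : Disjoint A C := disjoint_left.2 fun x hx hx' => (hC' x hx').1 (hA' x hx).1
    have hi : (A ∪ C) ∩ I₀ = A := by
      ext x; simp only [mem_inter, mem_union]; grind
    simp only [coe_filter, mem_powersetCard, subset_univ, true_and, Set.mem_ofPred_eq]
    refine ⟨by rw [card_union_of_disjoint hd]; omega, by rw [hi, hAc], ?_⟩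
    rw [disjoint_left]; intro x hx hx'; grind
  · intro J _
    ext x; simp only [mem_union, mem_inter, Finset.mem_sdiff]; tauto
  · rintro ⟨A, C⟩ h
    simp only [coe_product, Set.mem_prod, mem_coe, mem_powersetCard] at h
    obtain ⟨⟨hA, hAc⟩, hC, hCc⟩ := h
    have hA' : ∀ x ∈ A, x ∈ I₀ ∧ x ∉ I := fun x hx => by simpa using hA hx
    have hC' : ∀ x ∈ C, x ∉ I₀ ∧ x ∉ I := fun x hx => by simpa using hC hx
    ext x <;> simp only [mem_union, mem_inter, Finset.mem_sdiff] <;> grind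

/-- A weight on the `k`-sets is determined by its sums over the `k`-sets avoiding each `l`-set,
provided `k ≤ l` and `k + l ≤ n`. -/
theorem eq_zero_of_sum_disjoint_eq_zero {α : Type*} [Fintype α] [DecidableEq α] {k l : ℕ}
    (hkl : k ≤ l) (hn : k + l ≤ Fintype.card α) (a : Finset α → ℝ)
    (h : ∀ J ∈ powersetCard l (univ : Finset α),
      ∑ I ∈ powersetCard k (univ : Finset α), a I * (if Disjoint I J then 1 else 0) = 0)
    (I₀ : Finset α) (hI₀ : #I₀ = k) : a I₀ = 0 := by
  set n := Fintype.card α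
  set A : ℕ → ℝ := fun i => ∑ I ∈ powersetCard k (univ : Finset α) with #(I ∩ I₀) = i, a I
    with hA
  -- Summing the hypothesis over all `J` with `#(J ∩ I₀) = j` leaves a linear system in the class
  -- sums `A i`.
  have key : ∀ j ≤ l, ∑ i ∈ range (k + 1),
      A i * (((k - i).choose j * (n - (2 * k - i)).choose (l - j) : ℕ) : ℝ) = 0 := by
    intro j hj
    have h0 : ∑ J ∈ powersetCard l (univ : Finset α) with #(J ∩ I₀) = j,
        ∑ I ∈ powersetCard k (univ : Finset α), a I * (if Disjoint I J then 1 else 0) = 0 :=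
      sum_eq_zero fun J hJ => h J (mem_filter.1 hJ).1
    rw [sum_comm] at h0
    rw [← h0, ← sum_fiberwise_of_maps_to (s := powersetCard k (univ : Finset α))
      (t := range (k + 1)) (g := fun I => #(I ∩ I₀))
      (fun I hI => mem_range.2 (Nat.lt_succ_of_le (hI₀ ▸ card_le_card inter_subset_right)))]
    refine sum_congr rfl fun i _ => ?_
    rw [hA, sum_mul]
    refine sum_congr rfl fun I hI => ?_
    simp only [mem_filter, mem_powersetCard, subset_univ, true_and] at hI
    rw [← mul_sum, sum_boole, filter_filter, card_disjoint_inter_eq I I₀ hj]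
    have h1 := card_sdiff_add_card_inter I₀ I
    have h2 := card_union_add_card_inter I₀ I
    rw [inter_comm, hI.2, hI₀] at h1
    rw [inter_comm, hI.2, hI₀, hI.1] at h2
    rw [card_compl, show #(I₀ \ I) = k - i by omega, show #(I₀ ∪ I) = 2 * k - i by omega]
  have hzero : ∀ i ≤ k, A i = 0 := by
    intro i
    induction i using Nat.strong_induction_on with
    | _ i ih =>
      intro hi
      -- With `j = k - i` the system is triangular: terms beyond `i` have `(k - b).choose (k - i) =
      -- 0`, and earlier ones vanish by induction. The diagonal coefficient is nonzero because `k +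
      -- l ≤ n`.
      have h1 := key (k - i) (by omega)
      rw [sum_eq_single i] at h1
      · rcases mul_eq_zero.1 h1 with h2 | h2
        · exact h2
        · exfalso
          rw [Nat.cast_eq_zero, Nat.choose_self, one_mul] at h2
          exact (Nat.choose_pos (by omega)).ne' h2
      · intro b hb hbi
        rcases lt_or_gt_of_ne hbi with hlt | hgt
        · rw [ih b hlt (by omega), zero_mul]
        · have := mem_range.1 hb
          rw [Nat.choose_eq_zero_of_lt (n := k - b) (by omega)]; simp
      · intro hb; exact absurd (mem_range.2 (by omega)) hb
  have hk := hzero k le_rfl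
  rw [hA] at hk
  have hs : ({I ∈ powersetCard k (univ : Finset α) | #(I ∩ I₀) = k} : Finset _) = {I₀} := by
    ext I
    simp only [mem_filter, mem_powersetCard, subset_univ, true_and, mem_singleton]
    constructor
    · rintro ⟨h1, h2⟩
      have e1 : I ∩ I₀ = I := eq_of_subset_of_card_le inter_subset_left (by omega)
      have e2 : I ∩ I₀ = I₀ := eq_of_subset_of_card_le inter_subset_right (by omega)
      rw [← e1, e2]
    · rintro rfl; simp [hI₀]
  simpa [hs] using hk

/-! ### The disjointness matrix and its traces -/

/-- The disjointness matrix of the `k`-sets against the `l`-sets. -/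
def disjMatrix (n k l : ℕ) : Matrix (rowIndex n k) (rowIndex n l) ℝ :=
  Matrix.of fun I J => if Disjoint I.1 J.1 then 1 else 0

theorem transpose_disjMatrix (n k l : ℕ) : (disjMatrix n k l).transpose = disjMatrix n l k := by
  ext I J; simp [disjMatrix, disjoint_comm]

theorem card_of_mem_rowIndex {n k : ℕ} (I : rowIndex n k) : #I.1 = k :=
  (mem_powersetCard.1 I.2).2

theorem card_rowIndex (n k : ℕ) : Fintype.card (rowIndex n k) = n.choose k := by
  simp [rowIndex]

theorem rank_disjMatrix {n k l : ℕ} (hkl : k ≤ l) (hn : k + l ≤ n) :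
    (disjMatrix n k l).rank = n.choose k := by
  rw [← card_rowIndex]
  refine LinearIndependent.rank_matrix (Fintype.linearIndependent_iff.2 fun g hg I₀ => ?_)
  have := eq_zero_of_sum_disjoint_eq_zero hkl (by simpa using hn)
    (fun I => if h : I ∈ rowIndex n k then g ⟨I, h⟩ else 0) ?_ I₀.1 (card_of_mem_rowIndex I₀)
  · simpa using this
  · intro J hJ
    have h1 : (∑ I, g I • (disjMatrix n k l).row I) ⟨J, hJ⟩ = (0 : ℝ) := congrFun hg ⟨J, hJ⟩
    refine Eq.trans ?_ h1
    rw [Finset.sum_apply]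
    change ∑ I ∈ rowIndex n k, _ = _
    rw [← sum_coe_sort]
    refine sum_congr rfl fun I _ => ?_
    simp [disjMatrix, Matrix.row]

/-- The Gram matrix of the rows counts the `l`-sets disjoint from both `I` and `I'`. -/
theorem disjMatrix_mul_transpose_apply {n k l : ℕ} (I I' : rowIndex n k) :
    (disjMatrix n k l * (disjMatrix n k l).transpose) I I' =
      ((n - #(I.1 ∪ I'.1)).choose l : ℝ) := by
  have h : ((n - #(I.1 ∪ I'.1)).choose l) =
      #{J ∈ powersetCard l (univ : Finset (Fin n)) | Disjoint I.1 J ∧ Disjoint I'.1 J} := by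
    have : #(I.1 ∪ I'.1)ᶜ = n - #(I.1 ∪ I'.1) := by rw [card_compl, Fintype.card_fin]
    rw [← this, ← card_powersetCard]
    congr 1
    ext J
    simp only [mem_powersetCard, mem_filter, subset_univ, true_and, subset_compl_iff_disjoint_left,
      disjoint_union_left]
    tauto
  rw [h, ← sum_boole, Matrix.mul_apply]
  change _ = ∑ J ∈ rowIndex n l, if Disjoint I.1 J ∧ Disjoint I'.1 J then (1 : ℝ) else 0
  rw [← sum_coe_sort (rowIndex n l)]
  refine sum_congr rfl fun J _ => ?_
  simp only [disjMatrix, Matrix.of_apply, Matrix.transpose_apply, ite_and]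
  split_ifs <;> simp

theorem trace_disjMatrix_mul_transpose (n k l : ℕ) :
    (disjMatrix n k l * (disjMatrix n k l).transpose).trace =
      n.choose k * (n - k).choose l := by
  simp only [Matrix.trace, Matrix.diag, disjMatrix_mul_transpose_apply, union_self,
    card_of_mem_rowIndex]
  rw [sum_const, card_univ, card_rowIndex, nsmul_eq_mul]

theorem le_trace_disjMatrix_sq (n k l : ℕ) :
    (n.choose k * (k * (n - k : ℕ) * ((n - k - 1).choose l) ^ 2) : ℝ) ≤
      ((disjMatrix n k l * (disjMatrix n k l).transpose) *
        (disjMatrix n k l * (disjMatrix n k l).transpose)).trace := by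
  have hrow : ∀ I : rowIndex n k, (k * (n - k : ℕ) * ((n - k - 1).choose l) ^ 2 : ℝ) ≤
      ((disjMatrix n k l * (disjMatrix n k l).transpose) *
        (disjMatrix n k l * (disjMatrix n k l).transpose)) I I := by
    intro I
    have hI := card_of_mem_rowIndex I
    rw [Matrix.mul_apply]
    simp only [disjMatrix_mul_transpose_apply, union_comm _ I.1, ← sq]
    rw [sum_coe_sort (rowIndex n k) (fun J => ((n - #(I.1 ∪ J)).choose l : ℝ) ^ 2)]
    -- The neighbours of `I` are obtained by exchanging one element of `I` for one outside; distinct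
    -- exchanges give distinct sets, each with `#(I ∪ J) = k + 1`.
    have hinj : Set.InjOn (fun p : Fin n × Fin n => insert p.2 (I.1.erase p.1))
        (I.1 ×ˢ I.1ᶜ : Finset _) := by
      rintro ⟨a, b⟩ hp ⟨c, d⟩ hq heq
      simp only [coe_product, Set.mem_prod, mem_coe, mem_compl] at hp hq
      simp only [Finset.ext_iff, mem_insert, mem_erase] at heq
      have h1 := heq b
      have h2 := heq a
      have h3 := heq c
      grind
    have hsub : (I.1 ×ˢ I.1ᶜ).image (fun p : Fin n × Fin n => insert p.2 (I.1.erase p.1)) ⊆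
        rowIndex n k := by
      intro J hJ
      obtain ⟨⟨a, b⟩, hp, rfl⟩ := mem_image.1 hJ
      simp only [mem_product, mem_compl] at hp
      have := card_pos.2 ⟨a, hp.1⟩
      simp only [rowIndex, mem_powersetCard, subset_univ, true_and]
      rw [card_insert_of_notMem (fun h => hp.2 (mem_of_mem_erase h)), card_erase_of_mem hp.1]
      omega
    refine le_trans (le_of_eq ?_) (sum_le_sum_of_subset_of_nonneg hsub fun _ _ _ => sq_nonneg _)
    rw [sum_image hinj]
    have hval : ∀ p ∈ I.1 ×ˢ I.1ᶜ, ((n - #(I.1 ∪ insert p.2 (I.1.erase p.1))).choose l : ℝ) ^ 2 =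
        ((n - k - 1).choose l : ℝ) ^ 2 := by
      rintro ⟨a, b⟩ hp
      simp only [mem_product, mem_compl] at hp
      have : I.1 ∪ insert b (I.1.erase a) = insert b I.1 := by
        ext x; simp only [mem_union, mem_insert, mem_erase]; tauto
      simp only [this]
      rw [card_insert_of_notMem hp.2, hI, Nat.sub_sub]
    rw [sum_congr rfl hval, sum_const, card_product, card_compl, hI]
    simp
  calc _ = ∑ I : rowIndex n k, (k * (n - k : ℕ) * ((n - k - 1).choose l) ^ 2 : ℝ) := by
        rw [sum_const, card_univ, card_rowIndex, nsmul_eq_mul]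
    _ ≤ _ := sum_le_sum fun I _ => hrow I

/-! ### Coordinates of the derivatives of `esymm` -/

/-- The exponent vector of the squarefree monomial `∏ i ∈ S, x i`. -/
noncomputable def indicatorExp {n : ℕ} (S : Finset (Fin n)) : Fin n →₀ ℕ := ∑ i ∈ S, Finsupp.single i 1

theorem indicatorExp_apply {n : ℕ} (S : Finset (Fin n)) (i : Fin n) :
    indicatorExp S i = if i ∈ S then 1 else 0 := by
  simp [indicatorExp, Finsupp.finsetSum_apply, Finsupp.single_apply]

theorem indicatorExp_injective {n : ℕ} :
    Function.Injective (indicatorExp : Finset (Fin n) → Fin n →₀ ℕ) := by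
  intro S T h
  ext i
  have := DFunLike.congr_fun h i
  rw [indicatorExp_apply, indicatorExp_apply] at this
  split_ifs at this <;> simp_all

/-- An arbitrary list makes the induction possible; having no duplicates keeps `J i` unshifted when
`x i` is differentiated. -/
theorem coeff_foldr_pderiv {n : ℕ} (I : Finset (Fin n)) (f : MvPolynomial (Fin n) ℝ)
    (L : List (Fin n)) (hL : L.Nodup) (J : Fin n →₀ ℕ) :
    coeff J (L.foldr (fun i g => (⇑(pderiv i))^[if i ∈ I then 1 else 0] g) f) =
      coeff (J + indicatorExp (L.toFinset ∩ I)) f * ∏ i ∈ L.toFinset ∩ I, ((J i : ℝ) + 1) := by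
  induction L generalizing J with
  | nil => simp [indicatorExp]
  | cons i L ih =>
    obtain ⟨hi, hL⟩ := List.nodup_cons.1 hL
    by_cases hiI : i ∈ I
    · have hins : (i :: L).toFinset ∩ I = insert i (L.toFinset ∩ I) := by
        ext j; simp only [List.toFinset_cons, mem_inter, mem_insert]; grind
      have hni : i ∉ L.toFinset ∩ I := by simp [hi]
      rw [List.foldr_cons, if_pos hiI, Function.iterate_one, coeff_pderiv, ih hL, hins,
        prod_insert hni]
      have hp : ∏ j ∈ L.toFinset ∩ I, ((((J + Finsupp.single i 1 : Fin n →₀ ℕ) j : ℕ) : ℝ) + 1) =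
          ∏ j ∈ L.toFinset ∩ I, ((J j : ℝ) + 1) := by
        refine prod_congr rfl fun j hj => ?_
        have : i ≠ j := fun h => hni (h ▸ hj)
        simp [this]
      rw [hp, indicatorExp, indicatorExp, sum_insert hni, add_assoc]
      ring
    · have hins : (i :: L).toFinset ∩ I = L.toFinset ∩ I := by
        ext j; simp only [List.toFinset_cons, mem_inter, mem_insert]; grind
      rw [List.foldr_cons, if_neg hiI, Function.iterate_zero, id, ih hL, hins]

theorem coeff_setDeriv {n : ℕ} (I : Finset (Fin n)) (f : MvPolynomial (Fin n) ℝ)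
    (J : Fin n →₀ ℕ) :
    coeff J (setDeriv I f) = coeff (J + indicatorExp I) f * ∏ i ∈ I, ((J i : ℝ) + 1) := by
  have h := coeff_foldr_pderiv I f (List.finRange n) (List.nodup_finRange n) J
  rwa [List.toFinset_finRange, univ_inter] at h

theorem coeff_esymm {n : ℕ} (d : ℕ) (K : Fin n →₀ ℕ) :
    coeff K (esymm (Fin n) ℝ d) = if ∃ T, #T = d ∧ indicatorExp T = K then 1 else 0 := by
  rw [esymm_eq_sum_monomial, coeff_sum]
  simp only [coeff_monomial]
  change ∑ T ∈ powersetCard d univ, (if indicatorExp T = K then (1 : ℝ) else 0) = _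
  split_ifs with h
  · obtain ⟨T, hT, rfl⟩ := h
    rw [sum_eq_single T]
    · simp
    · intro S _ hS
      rw [if_neg fun h => hS (indicatorExp_injective h)]
    · intro h; exact absurd (mem_powersetCard.2 ⟨subset_univ _, hT⟩) h
  · refine sum_eq_zero fun T hT => if_neg fun hTK => h ⟨T, (mem_powersetCard.1 hT).2, hTK⟩

theorem exists_indicatorExp_of_coeff_setDeriv_ne_zero {n d : ℕ} {I : Finset (Fin n)}
    {J : Fin n →₀ ℕ} (h : coeff J (setDeriv I (esymm (Fin n) ℝ d)) ≠ 0) :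
    ∃ S, #S = d - #I ∧ indicatorExp S = J := by
  rw [coeff_setDeriv, coeff_esymm] at h
  have h' := left_ne_zero_of_mul h
  rw [ne_eq, ite_eq_right_iff, not_forall] at h'
  obtain ⟨⟨T, hT, hTJ⟩, -⟩ := h'
  have hval : ∀ i, (if i ∈ T then 1 else 0) = J i + if i ∈ I then 1 else 0 := fun i => by
    rw [← indicatorExp_apply, ← indicatorExp_apply, hTJ, Finsupp.add_apply]
  have hIT : I ⊆ T := fun i hi => by
    have := hval i
    rw [if_pos hi] at this
    by_contra hiT
    rw [if_neg hiT] at this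
    omega
  refine ⟨T \ I, by rw [card_sdiff_of_subset hIT, hT], ?_⟩
  ext i
  have := hval i
  rw [indicatorExp_apply]
  by_cases hiI : i ∈ I
  · simp only [hiI, hIT hiI, if_true] at this
    simp [hiI]; omega
  · simpa [hiI] using this

theorem scaledCoeff_setDeriv_esymm {n d : ℕ} {I S : Finset (Fin n)} (hd : #I + #S = d) :
    scaledCoeff (indicatorExp S) (setDeriv I (esymm (Fin n) ℝ d)) =
      if Disjoint I S then 1 else 0 := by
  have h1 : ∏ i, ((indicatorExp S i).factorial : ℝ) = 1 :=
    prod_eq_one fun i _ => by rw [indicatorExp_apply]; split_ifs <;> simp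
  rw [scaledCoeff, h1, one_mul, coeff_setDeriv, coeff_esymm]
  by_cases hIS : Disjoint I S
  · rw [if_pos hIS, if_pos, one_mul]
    · refine prod_eq_one fun i hi => ?_
      rw [indicatorExp_apply, if_neg (disjoint_left.1 hIS hi)]; simp
    · refine ⟨S ∪ I, by rw [card_union_of_disjoint hIS.symm]; omega, ?_⟩
      exact sum_union hIS.symm
  · rw [if_neg hIS, if_neg, zero_mul]
    rintro ⟨T, -, hT⟩
    obtain ⟨i, hi, hi'⟩ := not_disjoint_iff.1 hIS
    have := DFunLike.congr_fun hT i
    rw [Finsupp.add_apply, indicatorExp_apply, indicatorExp_apply, indicatorExp_apply,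
      if_pos hi, if_pos hi'] at this
    split_ifs at this
    all_goals omega

/-- The two matrices have different column types, so their row Gram matrices are compared: every
column of the first is a squarefree monomial given by an `l`-set, and `l`-sets not occurring
contribute zero. -/
theorem derivMatrix_esymm_mul_transpose {n k l : ℕ} :
    derivMatrix k (esymm (Fin n) ℝ (k + l)) *
        (derivMatrix k (esymm (Fin n) ℝ (k + l))).transpose =
      disjMatrix n k l * (disjMatrix n k l).transpose := by
  ext I I'
  have hI := card_of_mem_rowIndex I
  have hI' := card_of_mem_rowIndex I'
  set f := esymm (Fin n) ℝ (k + l)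
  rw [Matrix.mul_apply, Matrix.mul_apply]
  change ∑ J : colIndex k f, scaledCoeff J.1 (setDeriv I.1 f) * scaledCoeff J.1 (setDeriv I'.1 f) =
    ∑ S : rowIndex n l, (if Disjoint I.1 S.1 then (1 : ℝ) else 0) *
      (if Disjoint I'.1 S.1 then 1 else 0)
  rw [sum_coe_sort (colIndex k f)
      (fun J => scaledCoeff J (setDeriv I.1 f) * scaledCoeff J (setDeriv I'.1 f)),
    sum_coe_sort (rowIndex n l) (fun S => (if Disjoint I.1 S then (1 : ℝ) else 0) *
      (if Disjoint I'.1 S then 1 else 0))]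
  have hsub : colIndex k f ⊆ (rowIndex n l).image indicatorExp := by
    intro J hJ
    obtain ⟨K, hK, hKJ⟩ := mem_biUnion.1 hJ
    obtain ⟨S, hS, rfl⟩ := exists_indicatorExp_of_coeff_setDeriv_ne_zero (mem_support_iff.1 hKJ)
    have hKk : #K = k := (mem_powersetCard.1 hK).2
    exact mem_image_of_mem _ (mem_powersetCard.2 ⟨subset_univ _, by omega⟩)
  rw [sum_subset hsub, sum_image indicatorExp_injective.injOn]
  · refine sum_congr rfl fun S hS => ?_
    have hS' : #S = l := (mem_powersetCard.1 hS).2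
    rw [scaledCoeff_setDeriv_esymm (by omega), scaledCoeff_setDeriv_esymm (by omega)]
  · intro J _ hJ
    have : coeff J (setDeriv I.1 f) = 0 := by
      by_contra h
      exact hJ (mem_biUnion.2 ⟨I.1, I.2, mem_support_iff.2 h⟩)
    rw [scaledCoeff, this, mul_zero, zero_mul]

/-! ### Comparison of the trace bound with the dimension -/

theorem traceBound_esymm (n k l : ℕ) :
    traceBound k (esymm (Fin n) ℝ (k + l)) =
      (disjMatrix n k l * (disjMatrix n k l).transpose).trace ^ 2 /
      ((disjMatrix n k l * (disjMatrix n k l).transpose) *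
        (disjMatrix n k l * (disjMatrix n k l).transpose)).trace := by
  rw [traceBound, gramMatrix, Matrix.trace_mul_comm, ← derivMatrix_esymm_mul_transpose]
  congr 1
  rw [Matrix.mul_assoc, Matrix.trace_mul_comm]
  simp only [Matrix.mul_assoc]

theorem finite_derivSpace {n : ℕ} (k : ℕ) (f : MvPolynomial (Fin n) ℝ) :
    Module.Finite ℝ (derivSpace k f) := by
  refine FiniteDimensional.span_of_finite ℝ
    (((Set.finite_Iic (fun _ : Fin n => k)).image fun β => partialDeriv β f).subset ?_)
  rintro g ⟨β, hβ, rfl⟩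
  exact ⟨β, fun i => hβ ▸ single_le_sum (fun _ _ => Nat.zero_le _) (mem_univ i), rfl⟩

/-- Reading off the squarefree coordinates is a linear map sending the derivatives `∂_I` to the rows
of the matrix. -/
theorem rank_disjMatrix_le_derivDim (n k l : ℕ) :
    (disjMatrix n k l).rank ≤ derivDim k (esymm (Fin n) ℝ (k + l)) := by
  have := finite_derivSpace k (esymm (Fin n) ℝ (k + l))
  let φ : MvPolynomial (Fin n) ℝ →ₗ[ℝ] (rowIndex n l → ℝ) :=
    LinearMap.pi fun S => (∏ i, ((indicatorExp S.1 i).factorial : ℝ)) •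
      lcoeff ℝ (indicatorExp S.1)
  rw [Matrix.rank_eq_finrank_span_row, derivDim]
  refine le_trans (Submodule.finrank_mono ?_)
    (Submodule.finrank_map_le φ (derivSpace k (esymm (Fin n) ℝ (k + l))))
  rw [Submodule.span_le]
  rintro _ ⟨I, rfl⟩
  have hI := card_of_mem_rowIndex I
  refine ⟨setDeriv I.1 (esymm (Fin n) ℝ (k + l)), Submodule.subset_span ⟨_, ?_, rfl⟩, ?_⟩
  · simp [hI]
  · ext S
    have hS := card_of_mem_rowIndex S
    exact scaledCoeff_setDeriv_esymm (by omega)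

theorem choose_min_le_derivDim {n k l : ℕ} (hn : k + l ≤ n) :
    n.choose (min k l) ≤ derivDim k (esymm (Fin n) ℝ (k + l)) := by
  refine le_trans (le_of_eq ?_) (rank_disjMatrix_le_derivDim n k l)
  rcases le_total k l with h | h
  · rw [min_eq_left h, rank_disjMatrix h hn]
  · rw [min_eq_right h, ← Matrix.rank_transpose, transpose_disjMatrix,
      rank_disjMatrix h (by omega)]

/-- The trace method, compared with the number of rows of the disjointness matrix. -/
theorem trace_ratio_le {n k l : ℕ} (hk : 0 < k) (hn : 2 * (k + l) ≤ n) :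
    (disjMatrix n k l * (disjMatrix n k l).transpose).trace ^ 2 /
      ((disjMatrix n k l * (disjMatrix n k l).transpose) *
        (disjMatrix n k l * (disjMatrix n k l).transpose)).trace ≤ n.choose k * (4 / n) := by
  have hchoose : ((n - k - 1).choose l : ℝ) * (n - k : ℕ) =
      (n - k).choose l * (n - k - l : ℕ) := by
    have := Nat.choose_mul_succ_eq (n - k - 1) l
    rw [show n - k - 1 + 1 = n - k by omega] at this
    exact_mod_cast this
  have hC : (0 : ℝ) < n.choose k := by exact_mod_cast Nat.choose_pos (by omega)
  have hc1 : (0 : ℝ) < (n - k).choose l := by exact_mod_cast Nat.choose_pos (by omega)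
  have hc2 : (0 : ℝ) < (n - k - 1).choose l := by exact_mod_cast Nat.choose_pos (by omega)
  have hk1 : (1 : ℝ) ≤ k := by exact_mod_cast hk
  have ha : (0 : ℝ) < (n - k : ℕ) := by exact_mod_cast (by omega : 0 < n - k)
  have hn0 : (0 : ℝ) < n := by exact_mod_cast (by omega : 0 < n)
  have han : ((n - k : ℕ) : ℝ) ≤ n := by exact_mod_cast Nat.sub_le n k
  have hb : (n : ℝ) ≤ 2 * (n - k - l : ℕ) := by exact_mod_cast (by omega : n ≤ 2 * (n - k - l))
  have hT := le_trace_disjMatrix_sq n k l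
  rw [trace_disjMatrix_mul_transpose, ← mul_div_assoc]
  set C : ℝ := (n.choose k : ℝ)
  set c₁ : ℝ := ((n - k).choose l : ℝ)
  set c₂ : ℝ := ((n - k - 1).choose l : ℝ)
  set a : ℝ := ((n - k : ℕ) : ℝ)
  set b : ℝ := ((n - k - l : ℕ) : ℝ)
  have hmain : c₁ ^ 2 * n ≤ 4 * (k * a * c₂ ^ 2) := by
    have hb2 : (n : ℝ) ^ 2 ≤ 4 * b ^ 2 := by nlinarith
    have h1 : c₁ ^ 2 * n * n ≤ 4 * (k * a * c₂ ^ 2) * n := by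
      calc c₁ ^ 2 * n * n = c₁ ^ 2 * (n : ℝ) ^ 2 := by ring
        _ ≤ c₁ ^ 2 * (4 * b ^ 2) := by gcongr
        _ = 4 * (c₁ * b) ^ 2 := by ring
        _ = 4 * (1 * a * c₂ ^ 2) * a := by rw [← hchoose]; ring
        _ ≤ 4 * (k * a * c₂ ^ 2) * n := by gcongr
    exact le_of_mul_le_mul_right h1 hn0
  have hpos : 0 < C * (k * a * c₂ ^ 2) := by positivity
  refine (div_le_div_of_nonneg_left (by positivity) hpos hT).trans ?_
  rw [div_le_div_iff₀ hpos hn0]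
  calc (C * c₁) ^ 2 * n = C ^ 2 * (c₁ ^ 2 * n) := by ring
    _ ≤ C ^ 2 * (4 * (k * a * c₂ ^ 2)) := by gcongr
    _ = _ := by ring

/-- Both traces are unchanged when the matrix is transposed, so the smaller of `k` and `l` may index
the rows. -/
theorem traceBound_esymm_le {n k l : ℕ} (hk : 0 < k) (hl : 0 < l) (hn : 2 * (k + l) ≤ n) :
    traceBound k (esymm (Fin n) ℝ (k + l)) ≤ n.choose (min k l) * (4 / n) := by
  rw [traceBound_esymm]
  rcases le_total k l with h | h
  · rw [min_eq_left h]
    exact trace_ratio_le hk hn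
  · rw [min_eq_right h]
    refine le_trans (le_of_eq ?_) (trace_ratio_le hl (by omega : 2 * (l + k) ≤ n))
    rw [← transpose_disjMatrix n k l, Matrix.transpose_transpose,
      Matrix.trace_mul_comm (disjMatrix n k l) (disjMatrix n k l).transpose]
    congr 1
    rw [Matrix.mul_assoc, Matrix.trace_mul_comm]
    simp only [Matrix.mul_assoc]

theorem traceBound_div_derivDim_esymm_le {n k l : ℕ} (hk : 0 < k) (hl : 0 < l)
    (hn : 2 * (k + l) ≤ n) :
    traceBound k (esymm (Fin n) ℝ (k + l)) / (derivDim k (esymm (Fin n) ℝ (k + l)) : ℝ) ≤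
      4 / n := by
  have hu : (n.choose (min k l) : ℝ) ≤ derivDim k (esymm (Fin n) ℝ (k + l)) := by
    exact_mod_cast choose_min_le_derivDim (by omega)
  have hC : (0 : ℝ) < n.choose (min k l) := by exact_mod_cast Nat.choose_pos (by omega)
  rw [div_le_iff₀ (hC.trans_le hu), mul_comm]
  exact (traceBound_esymm_le hk hl hn).trans (by gcongr)

theorem traceBound_nonneg {n : ℕ} (k : ℕ) (f : MvPolynomial (Fin n) ℝ) : 0 ≤ traceBound k f := by
  refine div_nonneg (sq_nonneg _) ?_
  have hs : (gramMatrix k f).transpose = gramMatrix k f := by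
    rw [gramMatrix, Matrix.transpose_mul, Matrix.transpose_transpose]
  refine sum_nonneg fun J _ => ?_
  rw [Matrix.diag_apply, Matrix.mul_apply]
  refine sum_nonneg fun K _ => ?_
  nth_rewrite 2 [← hs]
  exact mul_self_nonneg _

end PartialDerivatives

theorem mainTheorem8 (k' d' n' : ℕ) (hk : 0 < k') (hkd : k' < d')
    (hdn : (d' : ℝ) < (n' : ℝ) / 2) :
    Tendsto
      (fun m : ℕ =>
        PartialDerivatives.traceBound (k' * m) (MvPolynomial.esymm (Fin (n' * m)) ℝ (d' * m)) /
          (PartialDerivatives.derivDim (k' * m)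
            (MvPolynomial.esymm (Fin (n' * m)) ℝ (d' * m)) : ℝ))
      atTop (𝓝 0) := by
  obtain ⟨l', rfl⟩ := Nat.exists_eq_add_of_lt hkd
  have hn : 2 * (k' + (l' + 1)) ≤ n' := by
    have : ((2 * (k' + l' + 1) : ℕ) : ℝ) < n' := by push_cast at hdn ⊢; linarith
    exact (Nat.cast_lt.1 this).le
  -- Since `n = n' * m ≥ m`, the bound `4 / n` is at most `4 / m`; it needs `m > 0` for both set
  -- sizes to be positive.
  refine squeeze_zero' (g := fun m : ℕ => 4 / (m : ℝ)) (Eventually.of_forall fun m =>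
    div_nonneg (PartialDerivatives.traceBound_nonneg _ _) (Nat.cast_nonneg _)) ?_
    (tendsto_const_div_atTop_nhds_zero_nat 4)
  filter_upwards [eventually_gt_atTop 0] with m hm
  rw [show (k' + l' + 1) * m = k' * m + (l' + 1) * m by ring]
  refine (PartialDerivatives.traceBound_div_derivDim_esymm_le (by positivity) (by positivity)
    ?_).trans ?_
  · rw [← add_mul, ← mul_assoc]; exact Nat.mul_le_mul_right m hn
  · have h1 : (m : ℝ) ≤ (n' * m : ℕ) := by exact_mod_cast Nat.le_mul_of_pos_left m (by omega)
    have h2 : (0 : ℝ) < m := by exact_mod_cast hm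
    gcongr
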